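/- Let $\tau=\frac{1+\sqrt5}{2}$, $\tau'=\frac{1-\sqrt5}{2}$, and let $\mathbf{Fib}=\{m+n\tau : m,n\in\mathbb{Z},\ m+n\tau'\in[-1,\tau-1)\}$ be the Fibonacci model set. Let $\mathcal{A}=(A_n)$ be a van Hove sequence in $\mathbb{R}$, that is, a sequence of compact sets with Lebesgue measure $|A_n|>0$ such that $|\partial^K A_n|/|A_n|\to0$ for every nonempty compact $K\subset\mathbb{R}$, where $\partial^K B=((K+B)\setminus B^\circ)\cup((-K+\overline{\mathbb{R}\setminus B})\cap B)$. Let $\Lambda\subseteq\mathbf{Fib}$ be such that the limits $$\eta(z)=\lim_{n\to\infty}\frac{1}{|A_n|}\,\#\{(x,y) : x,y\in\Lambda\cap A_n,\ x-y=z\}$$ exist for all $z\in\Lambda-\Lambda$, and let $\gamma=\sum_{z\in\Lambda-\Lambda}\eta(z)\delta_z$ be the autocorrelation of $\Lambda$ with respect to $\mathcal{A}$. Let $\widehat{\gamma}$ be the diffraction measure of $\Lambda$, i.e. the Fourier transform of $\gamma$: the positive Radon measure on $\mathbb{R}$ such that for every continuous compactly supported $\varphi:\mathbb{R}\to\mathbb{C}$,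 with $\check\varphi(k)=\int_{\mathbb{R}} e^{2\pi i kx}\varphi(x)\,dx$ and $\tilde\varphi(x)=\overline{\varphi(-x)}$, one has $\check\varphi\in L^2(\widehat{\gamma})$ and $\int\varphi*\tilde\varphi\,d\gamma=\int|\check\varphi|^2\,d\widehat{\gamma}$. We say that $\Lambda$ has a Bragg peak at $k\in\mathbb{R}$ of intensity $\widehat{\gamma}(\{k\})$ if $\widehat{\gamma}(\{k\})>0$. Assume that $I:=\widehat{\gamma}(\{0\})>0$. Then: 1. For every $0<\varepsilon<1$ and every $x\in\mathbb{R}$, $\Lambda$ has a Bragg peak in the interval $\left[x,\,x+\frac{2\pi\tau^4}{5\varepsilon}\right]$ of intensity at least $(1-\varepsilon)I$. 2. For every $x\in\mathbb{R}$, $\Lambda$ has a Bragg peak in the interval $\left[x,\,x+\frac{2\pi\tau^4}{5}\right]$. -/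

import Mathlib

open Real MeasureTheory Filter Topology
open scoped Pointwise FourierTransform ComplexConjugate

noncomputable section

/-- For a window `W ⊆ ℝ`, the set of all `x = m + n τ` (`m, n ∈ ℤ`) whose Galois conjugate
`x⋆ = m + n τ'` lies in `W`. Here `τ = goldenRatio = (1 + √5) / 2` and
`τ' = goldenConj = (1 - √5) / 2`; the pair `(m, n)` is determined by `x`, as `τ` is irrational. -/
def goldenModelSet (W : Set ℝ) : Set ℝ :=
  {x | ∃ m n : ℤ, x = m + n * goldenRatio ∧ (m + n * goldenConj : ℝ) ∈ W}

/-- The Fibonacci model set, with window `[-1, τ - 1)`. -/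
def Fib : Set ℝ := goldenModelSet (Set.Ico (-1) (goldenRatio - 1))

/-- The `K`-boundary of `B`. -/
def kBoundary (K B : Set ℝ) : Set ℝ :=
  ((K + B) \ interior B) ∪ ((-K + closure Bᶜ) ∩ B)

/-- Van Hove sequences in `ℝ`: compact sets of positive Lebesgue measure whose `K`-boundaries are
asymptotically negligible, for every nonempty compact `K`. -/
structure IsVanHove (A : ℕ → Set ℝ) : Prop where
  isCompact : ∀ n, IsCompact (A n)
  volume_pos : ∀ n, 0 < volume (A n)
  tendsto_kBoundary : ∀ K : Set ℝ, IsCompact K → K.Nonempty →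
    Tendsto (fun n => volume.real (kBoundary K (A n)) / volume.real (A n)) atTop (𝓝 0)

/-- `γ` is the autocorrelation of (the Dirac comb of) `Λ` with respect to `A`: the limits
`η(z) = lim_n |A_n|⁻¹ · #{(x, y) : x, y ∈ Λ ∩ A_n, x - y = z}` exist for all `z ∈ Λ - Λ`, and
`γ = ∑_{z ∈ Λ - Λ} η(z) δ_z`. -/
def IsAutocorrelation (Λ : Set ℝ) (A : ℕ → Set ℝ) (γ : Measure ℝ) : Prop :=
  ∃ η : ℝ → ℝ,
    (∀ z ∈ Λ - Λ, Tendsto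
      (fun n => (Set.ncard {p : ℝ × ℝ | p.1 ∈ Λ ∩ A n ∧ p.2 ∈ Λ ∩ A n ∧ p.1 - p.2 = z} : ℝ)
        / volume.real (A n)) atTop (𝓝 (η z))) ∧
    γ = Measure.sum (fun z : ↥(Λ - Λ) => ENNReal.ofReal (η z) • Measure.dirac (z : ℝ))

/-- The positive Radon measure `ν` is the Fourier transform of the measure `μ`: for every
continuous compactly supported `φ`, the inverse Fourier transform `φˇ(k) = ∫ e^{2πikx} φ(x) dx` is
in `L²(ν)` and `μ(φ * φ~) = ν(|φˇ|²)`, where `φ~(x) = conj (φ (-x))`. The dual group of `ℝ` is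
identified with `ℝ`, the point `k` being the character `x ↦ e^{2πikx}`. -/
def IsFourierTransform (μ ν : Measure ℝ) : Prop :=
  IsLocallyFiniteMeasure ν ∧
    ∀ φ : ℝ → ℂ, Continuous φ → HasCompactSupport φ →
      MemLp (𝓕⁻ φ) 2 ν ∧
      ∫ x, (convolution φ (fun y => conj (φ (-y))) (ContinuousLinearMap.mul ℂ ℂ) volume) x ∂μ
        = ((∫ k, ‖𝓕⁻ φ k‖ ^ 2 ∂ν : ℝ) : ℂ)

/-- `ν` is the diffraction measure of `Λ` with respect to `A`: the autocorrelation of `Λ` exists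
with respect to `A`, and `ν` is its Fourier transform. -/
def IsDiffractionMeasure (Λ : Set ℝ) (A : ℕ → Set ℝ) (ν : Measure ℝ) : Prop :=
  ∃ γ : Measure ℝ, IsAutocorrelation Λ A γ ∧ IsFourierTransform γ ν

/-- The intensity `ν({k})` of a diffraction measure `ν` at `k`. -/
def braggIntensity (ν : Measure ℝ) (k : ℝ) : ℝ := ν.real {k}

/-- A diffraction measure has a Bragg peak at `k` if `k` is an atom. -/
def HasBraggPeak (ν : Measure ℝ) (k : ℝ) : Prop := 0 < braggIntensity ν k

end

/-!
On the Minkowski embedding `{(x, x⋆) : x ∈ ℤ[τ]}` the form `(p, q) ↦ p₁ q₁ - p₂ q₂` takes values in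
`√5 ℤ`. Hence, for `k = p₁ / √5`, the character `z ↦ e^{2πikz}` agrees on `ℤ[τ]` with
`z ↦ e^{2πi (p₂ / √5) z⋆}`, which is uniformly close to `1` on a model set with bounded window as
soon as `p₂` is small. Multiplication by powers of the unit `(τ, τ')` shows that the numbers `k`
arising from such lattice points are relatively dense, with an explicit gap.

On the analytic side, the intensities at `0` and at `k` are limits of integrals over the
autocorrelation of the same nonnegative functions, weighted by `cos (2 π k x)` for the latter.
A lower bound for this cosine on `Fib - Fib` is therefore a lower bound for the ratio of the
intensities.
-/

/-- The Minkowski embedding `{(x, x⋆) : x ∈ ℤ[τ]}` of the ring `ℤ[τ]`, where `⋆` is the Galois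
conjugation. It is the lattice of the cut and project scheme behind `goldenModelSet`, encoded as a
subring so that it can be multiplied by the powers of the unit `(τ, τ')`. -/
def goldenLattice : Subring (ℝ × ℝ) where
  carrier := {p | ∃ m n : ℤ, p = (m + n * goldenRatio, m + n * goldenConj)}
  zero_mem' := ⟨0, 0, by simp [Prod.ext_iff]⟩
  one_mem' := ⟨1, 0, by simp [Prod.ext_iff]⟩
  neg_mem' := by
    rintro _ ⟨m, n, rfl⟩
    refine ⟨-m, -n, Prod.ext ?_ ?_⟩ <;> simp only [Prod.neg_mk] <;> push_cast <;> ring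
  add_mem' := by
    rintro _ _ ⟨m, n, rfl⟩ ⟨m', n', rfl⟩
    refine ⟨m + m', n + n', Prod.ext ?_ ?_⟩ <;> simp only [Prod.mk_add_mk] <;> push_cast <;> ring
  mul_mem' := by
    rintro _ _ ⟨m, n, rfl⟩ ⟨m', n', rfl⟩
    refine ⟨m * m' + n * n', m * n' + n * m' + n * n', Prod.ext ?_ ?_⟩ <;>
      simp only [Prod.mk_mul_mk] <;> push_cast
    · linear_combination (n * n' : ℝ) * goldenRatio_sq
    · linear_combination (n * n' : ℝ) * goldenConj_sq

namespace goldenLattice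

lemma int_add_int_mul_golden_mem (m n : ℤ) :
    ((m + n * goldenRatio, m + n * goldenConj) : ℝ × ℝ) ∈ goldenLattice :=
  ⟨m, n, rfl⟩

lemma golden_zpow_mem (N : ℤ) : (goldenRatio ^ N, goldenConj ^ N) ∈ goldenLattice := by
  have hunit : (goldenRatio, goldenConj) ∈ goldenLattice := by
    simpa using int_add_int_mul_golden_mem 0 1
  have hinv : (goldenRatio⁻¹, goldenConj⁻¹) ∈ goldenLattice := by
    rw [inv_goldenRatio, inv_goldenConj]
    have hτ : -goldenConj = -1 + goldenRatio := by linarith [goldenRatio_add_goldenConj]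
    have hτ' : -goldenRatio = -1 + goldenConj := by linarith [goldenRatio_add_goldenConj]
    rw [hτ, hτ']
    simpa using int_add_int_mul_golden_mem (-1) 1
  cases N with
  | ofNat n => simpa using pow_mem hunit n
  | negSucc n => simpa only [zpow_negSucc, ← inv_pow, Prod.pow_mk] using pow_mem hinv (n + 1)

lemma exists_fst_sub_snd_eq_int_mul_sqrt_five {p : ℝ × ℝ} (hp : p ∈ goldenLattice) :
    ∃ n : ℤ, p.1 - p.2 = n * √5 := by
  obtain ⟨m, n, rfl⟩ := hp
  refine ⟨n, ?_⟩
  linear_combination (n : ℝ) * goldenRatio_sub_goldenConj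

lemma cos_two_pi_mul_fst_eq_cos_snd {p q : ℝ × ℝ} (hp : p ∈ goldenLattice)
    (hq : q ∈ goldenLattice) :
    cos (2 * π * (p.1 / √5) * q.1) = cos (2 * π * (p.2 / √5) * q.2) := by
  obtain ⟨n, hn⟩ := exists_fst_sub_snd_eq_int_mul_sqrt_five (mul_mem hp hq)
  rw [← cos_add_int_mul_two_pi (2 * π * (p.2 / √5) * q.2) n]
  congr 1
  simp only [Prod.fst_mul, Prod.snd_mul] at hn
  field_simp
  linear_combination hn

lemma exists_fst_mem_Icc_abs_snd_le_goldenRatio_div_two (y : ℝ) :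
    ∃ p ∈ goldenLattice, p.1 ∈ Set.Icc y (y + goldenRatio ^ 2) ∧ |p.2| ≤ goldenRatio / 2 := by
  -- Rounding up the coordinates of `(u + v τ, u + v τ')` adds a vector of
  -- `[0, τ ^ 2] × [1 - τ, 1]`; the start `(y, τ / 2 - 1)` centres its second component at `0`.
  obtain ⟨u, v, hu, hv⟩ :
      ∃ u v : ℝ, u + v * goldenRatio = y ∧ u + v * goldenConj = goldenRatio / 2 - 1 := by
    set v := (y - (goldenRatio / 2 - 1)) / √5 with hv
    refine ⟨y - v * goldenRatio, v, by ring, ?_⟩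
    have : v * √5 = y - (goldenRatio / 2 - 1) := by rw [hv]; field_simp
    linear_combination -this - v * goldenRatio_sub_goldenConj
  have hu₀ : 0 ≤ ⌈u⌉ - u := sub_nonneg.2 (Int.le_ceil u)
  have hu₁ : ⌈u⌉ - u ≤ 1 := by linarith [Int.ceil_lt_add_one u]
  have hv₀ : 0 ≤ ⌈v⌉ - v := sub_nonneg.2 (Int.le_ceil v)
  have hv₁ : ⌈v⌉ - v ≤ 1 := by linarith [Int.ceil_lt_add_one v]
  have hτ := goldenRatio_pos
  have hτ' := goldenConj_neg
  have hsum := goldenRatio_add_goldenConj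
  refine ⟨_, int_add_int_mul_golden_mem ⌈u⌉ ⌈v⌉, ⟨?_, ?_⟩, abs_le.2 ⟨?_, ?_⟩⟩ <;>
    simp only [goldenRatio_sq] <;> nlinarith

lemma exists_fst_mem_Icc_abs_snd_le {η : ℝ} (hη : 0 < η) (y : ℝ) :
    ∃ p ∈ goldenLattice, p.1 ∈ Set.Icc y (y + goldenRatio ^ 4 / (2 * η)) ∧ |p.2| ≤ η := by
  have hτ := goldenRatio_pos
  obtain ⟨M, hM, hM'⟩ := exists_mem_Ioc_zpow (x := goldenRatio / (2 * η)) (by positivity)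
    one_lt_goldenRatio
  set r := goldenRatio ^ (M + 1) with hr
  have hrpos : 0 < r := by positivity
  obtain ⟨p, hp, ⟨hp₁, hp₂⟩, hp'⟩ := exists_fst_mem_Icc_abs_snd_le_goldenRatio_div_two (y / r)
  refine ⟨_, mul_mem (golden_zpow_mem (M + 1)) hp, ⟨?_, ?_⟩, ?_⟩
  · exact (div_le_iff₀' hrpos).1 hp₁
  · calc r * p.1 ≤ r * (y / r + goldenRatio ^ 2) := by gcongr
      _ = y + goldenRatio ^ M * goldenRatio ^ 3 := by
        rw [mul_add, mul_div_cancel₀ _ hrpos.ne', hr, zpow_add_one₀ hτ.ne']; ring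
      _ ≤ y + goldenRatio / (2 * η) * goldenRatio ^ 3 := by gcongr
      _ = y + goldenRatio ^ 4 / (2 * η) := by ring
  · have hconj : |goldenConj| = goldenRatio⁻¹ := by
      rw [abs_of_neg goldenConj_neg, inv_goldenRatio]
    calc |goldenConj ^ (M + 1) * p.2| = r⁻¹ * |p.2| := by
          rw [abs_mul, abs_zpow, hconj, inv_zpow]
      _ ≤ (goldenRatio / (2 * η))⁻¹ * (goldenRatio / 2) := by gcongr
      _ = η := by field_simp

end goldenLattice

lemma mem_goldenModelSet_iff {W : Set ℝ} {x : ℝ} :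
    x ∈ goldenModelSet W ↔ ∃ w ∈ W, (x, w) ∈ goldenLattice := by
  constructor
  · rintro ⟨m, n, rfl, hw⟩
    exact ⟨_, hw, goldenLattice.int_add_int_mul_golden_mem m n⟩
  · rintro ⟨_, hw, m, n, h⟩
    obtain ⟨rfl, rfl⟩ := Prod.ext_iff.1 h
    exact ⟨m, n, rfl, hw⟩

lemma goldenModelSet_mono {V W : Set ℝ} (h : V ⊆ W) : goldenModelSet V ⊆ goldenModelSet W :=
  fun _ ⟨m, n, hx, hw⟩ => ⟨m, n, hx, h hw⟩

lemma goldenModelSet_sub_subset (V W : Set ℝ) :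
    goldenModelSet V - goldenModelSet W ⊆ goldenModelSet (V - W) := by
  rintro _ ⟨x, hx, y, hy, rfl⟩
  obtain ⟨v, hv, hxv⟩ := mem_goldenModelSet_iff.1 hx
  obtain ⟨w, hw, hyw⟩ := mem_goldenModelSet_iff.1 hy
  exact mem_goldenModelSet_iff.2 ⟨v - w, Set.sub_mem_sub hv hw, sub_mem hxv hyw⟩

lemma Fib_sub_Fib_subset : Fib - Fib ⊆ goldenModelSet (Set.Icc (-2) 2) := by
  refine (goldenModelSet_sub_subset _ _).trans (goldenModelSet_mono ?_)
  rintro _ ⟨v, ⟨hv, hv'⟩, w, ⟨hw, hw'⟩, rfl⟩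
  have := goldenRatio_lt_two
  constructor <;> linarith

lemma countable_goldenModelSet (W : Set ℝ) : (goldenModelSet W).Countable := by
  refine (Set.countable_range fun p : ℤ × ℤ => p.1 + p.2 * goldenRatio).mono ?_
  rintro _ ⟨m, n, rfl, -⟩
  exact ⟨(m, n), rfl⟩

lemma max_abs_le_abs_add_abs_golden (a b : ℝ) :
    max |a| |b| ≤ |a + b * goldenRatio| + |a + b * goldenConj| := by
  set x := a + b * goldenRatio
  set y := a + b * goldenConj
  have abs_le_of_abs_mul_sqrt_five_le {t : ℝ} (ht : |t * √5| ≤ 2 * (|x| + |y|)) :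
      |t| ≤ |x| + |y| := by
    have h5 : 2 ≤ √5 := Real.le_sqrt_of_sq_le (by norm_num)
    rw [abs_mul, abs_of_nonneg (Real.sqrt_nonneg 5)] at ht
    nlinarith [abs_nonneg t]
  have hτ : |goldenRatio| ≤ 2 := abs_le.2 ⟨by linarith [goldenRatio_pos], goldenRatio_lt_two.le⟩
  have hτ' : |goldenConj| ≤ 2 :=
    abs_le.2 ⟨by linarith [neg_one_lt_goldenConj], by linarith [goldenConj_neg]⟩
  refine max_le (abs_le_of_abs_mul_sqrt_five_le ?_) (abs_le_of_abs_mul_sqrt_five_le ?_)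
  · calc |a * √5| = |goldenRatio * y - goldenConj * x| := by
          congr 1
          linear_combination -a * goldenRatio_sub_goldenConj
      _ ≤ |goldenRatio| * |y| + |goldenConj| * |x| := by
          simpa only [abs_mul] using abs_sub (goldenRatio * y) (goldenConj * x)
      _ ≤ 2 * |y| + 2 * |x| := by gcongr
      _ = 2 * (|x| + |y|) := by ring
  · calc |b * √5| = |x - y| := by
          congr 1
          linear_combination -b * goldenRatio_sub_goldenConj
      _ ≤ |x| + |y| := abs_sub x y
      _ ≤ 2 * (|x| + |y|) := by linarith [abs_nonneg x, abs_nonneg y]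

lemma finite_goldenModelSet_inter {W S : Set ℝ} (hW : Bornology.IsBounded W)
    (hS : Bornology.IsBounded S) : (goldenModelSet W ∩ S).Finite := by
  obtain ⟨c, hc⟩ := hW.exists_norm_le
  obtain ⟨a, ha⟩ := hS.exists_norm_le
  have hball : (Metric.closedBall (0 : ℤ × ℤ) (a + c)).Finite :=
    isCompact_iff_finite.1 (isCompact_closedBall _ _)
  refine (hball.image fun p => p.1 + p.2 * goldenRatio).subset ?_
  rintro _ ⟨⟨m, n, rfl, hw⟩, hx⟩
  refine ⟨(m, n), ?_, rfl⟩
  rw [mem_closedBall_zero_iff, Prod.norm_def, Int.norm_eq_abs, Int.norm_eq_abs]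
  exact (max_abs_le_abs_add_abs_golden m n).trans (add_le_add (ha _ hx) (hc _ hw))

theorem isFiniteMeasureOnCompacts_sum_smul_dirac {ι X : Type*} [TopologicalSpace X] [T2Space X]
    [MeasurableSpace X] [OpensMeasurableSpace X] {c : ι → ENNReal} (hc : ∀ i, c i ≠ ⊤) {x : ι → X}
    (hx : ∀ K, IsCompact K → {i | x i ∈ K}.Finite) :
    IsFiniteMeasureOnCompacts (Measure.sum fun i => c i • Measure.dirac (x i)) := by
  refine ⟨fun K hK => ?_⟩
  rw [Measure.sum_apply _ hK.measurableSet, tsum_eq_sum (s := (hx K hK).toFinset)]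
  · refine ENNReal.sum_lt_top.2 fun i _ => ?_
    rw [Measure.smul_apply, smul_eq_mul]
    exact ENNReal.mul_lt_top (hc i).lt_top (measure_lt_top _ _)
  · intro i hi
    have hi : x i ∉ K := by simpa using hi
    simp [Measure.dirac_apply' _ hK.measurableSet, hi]

namespace IsAutocorrelation

variable {Λ : Set ℝ} {A : ℕ → Set ℝ} {γ : Measure ℝ}

lemma isLocallyFiniteMeasure (h : IsAutocorrelation Λ A γ)
    (hΛ : ∀ K, IsCompact K → ((Λ - Λ) ∩ K).Finite) : IsLocallyFiniteMeasure γ := by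
  obtain ⟨η, -, rfl⟩ := h
  have := isFiniteMeasureOnCompacts_sum_smul_dirac (c := fun z : ↥(Λ - Λ) => ENNReal.ofReal (η z))
    (fun _ => ENNReal.ofReal_ne_top) (x := fun z => (z : ℝ)) fun K hK =>
      ((hΛ K hK).preimage Subtype.val_injective.injOn).subset fun z hz => ⟨z.2, hz⟩
  infer_instance

lemma ae_mem_sub (h : IsAutocorrelation Λ A γ) (hΛ : (Λ - Λ).Countable) :
    ∀ᵐ z ∂γ, z ∈ Λ - Λ := by
  obtain ⟨η, -, rfl⟩ := h
  refine (Measure.ae_sum_iff' hΛ.measurableSet).2 fun z => Measure.ae_smul_measure ?_ _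
  exact (ae_dirac_iff hΛ.measurableSet).2 z.2

lemma isLocallyFiniteMeasure_of_subset_Fib (h : IsAutocorrelation Λ A γ) (hΛ : Λ ⊆ Fib) :
    IsLocallyFiniteMeasure γ :=
  h.isLocallyFiniteMeasure fun _ hK =>
    (finite_goldenModelSet_inter (Metric.isBounded_Icc _ _) hK.isBounded).subset <|
      Set.inter_subset_inter_left _ ((Set.sub_subset_sub hΛ hΛ).trans Fib_sub_Fib_subset)

lemma ae_mem_goldenModelSet_of_subset_Fib (h : IsAutocorrelation Λ A γ) (hΛ : Λ ⊆ Fib) :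
    ∀ᵐ z ∂γ, z ∈ goldenModelSet (Set.Icc (-2) 2) := by
  have hsub : Λ - Λ ⊆ goldenModelSet (Set.Icc (-2) 2) :=
    (Set.sub_subset_sub hΛ hΛ).trans Fib_sub_Fib_subset
  exact (h.ae_mem_sub ((countable_goldenModelSet _).mono hsub)).mono fun _ hz => hsub hz

end IsAutocorrelation

section Fourier

open scoped Convolution

/-- The function `φ` multiplied by the character `x ↦ e^{-2πikx}`, which shifts its inverse Fourier
transform by `k`. -/
noncomputable def modulate (k : ℝ) (φ : ℝ → ℂ) (x : ℝ) : ℂ := 𝐞 (-(k * x)) • φ x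

lemma continuous_modulate (k : ℝ) {φ : ℝ → ℂ} (hφ : Continuous φ) :
    Continuous (modulate k φ) :=
  (continuous_fourierChar.comp (by fun_prop : Continuous fun x => -(k * x))).smul hφ

lemma hasCompactSupport_modulate (k : ℝ) {φ : ℝ → ℂ} (hφ : HasCompactSupport φ) :
    HasCompactSupport (modulate k φ) :=
  hφ.smul_left

lemma fourierInv_modulate (k : ℝ) (φ : ℝ → ℂ) (y : ℝ) :
    𝓕⁻ (modulate k φ) y = 𝓕⁻ φ (y - k) := by
  simp only [fourierInv_eq, modulate, smul_smul, ← AddChar.map_add_eq_mul]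
  congr! 4 with x
  simp only [RCLike.inner_apply, conj_trivial]
  ring

lemma modulate_convolution_conj_neg (k : ℝ) (φ : ℝ → ℂ) (x : ℝ) :
    (modulate k φ ⋆[ContinuousLinearMap.mul ℂ ℂ] fun y => conj (modulate k φ (-y))) x =
      𝐞 (-(k * x)) • (φ ⋆[ContinuousLinearMap.mul ℂ ℂ] fun y => conj (φ (-y))) x := by
  simp only [convolution_mul, Circle.smul_def, ← integral_smul]
  congr! 2 with t
  have hchar : 𝐞 (-(k * x)) = 𝐞 (-(k * t)) * (𝐞 (-(k * -(x - t))))⁻¹ := by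
    rw [← AddChar.map_neg_eq_inv, ← AddChar.map_add_eq_mul]
    congr 1
    ring
  simp only [modulate, Circle.smul_def, smul_eq_mul, map_mul, hchar, Circle.coe_mul,
    Circle.coe_inv_eq_conj]
  ring

lemma ofReal_convolution {G : Type*} [MeasurableSpace G] [Sub G] {μ : Measure G} (f g : G → ℝ)
    (x : G) :
    ((fun t => (f t : ℂ)) ⋆[ContinuousLinearMap.mul ℂ ℂ, μ] fun t => (g t : ℂ)) x =
      ((f ⋆[ContinuousLinearMap.mul ℝ ℝ, μ] g) x : ℝ) := by
  simp only [convolution_mul, ← integral_complex_ofReal, Complex.ofReal_mul]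

lemma convolution_nonneg {G : Type*} [MeasurableSpace G] [Sub G] {μ : Measure G} {f g : G → ℝ}
    (hf : 0 ≤ f) (hg : 0 ≤ g) : 0 ≤ f ⋆[ContinuousLinearMap.mul ℝ ℝ, μ] g :=
  fun _ => integral_nonneg fun _ => mul_nonneg (hf _) (hg _)

/-- The function `x ↦ ∫ f(t) f(t - x) dt`, that is `f * f~` for real-valued `f`. -/
noncomputable def selfCorrelation (f : ℝ → ℝ) : ℝ → ℝ :=
  f ⋆[ContinuousLinearMap.mul ℝ ℝ] fun t => f (-t)

lemma selfCorrelation_nonneg {f : ℝ → ℝ} (hf : 0 ≤ f) : 0 ≤ selfCorrelation f :=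
  convolution_nonneg hf fun x => hf (-x)

lemma integrable_selfCorrelation {f : ℝ → ℝ} (hf : Continuous f) (hc : HasCompactSupport f)
    (γ : Measure ℝ) [IsLocallyFiniteMeasure γ] : Integrable (selfCorrelation f) γ := by
  have hc' : HasCompactSupport fun t => f (-t) := hc.comp_homeomorph (Homeomorph.neg ℝ)
  refine Continuous.integrable_of_hasCompactSupport ?_ (hc.convolution _ hc')
  exact hc'.continuous_convolution_right _ hf.locallyIntegrable (by fun_prop)

/-- The function `f` stretched by the factor `R` and rescaled so as to keep its integral. -/
noncomputable def stretch (R : ℝ) (f : ℝ → ℝ) (x : ℝ) : ℝ := R⁻¹ * f (R⁻¹ * x)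

lemma continuous_stretch (R : ℝ) {f : ℝ → ℝ} (hf : Continuous f) : Continuous (stretch R f) := by
  unfold stretch
  fun_prop

lemma hasCompactSupport_stretch {R : ℝ} (hR : R ≠ 0) {f : ℝ → ℝ} (hf : HasCompactSupport f) :
    HasCompactSupport (stretch R f) :=
  (hf.comp_homeomorph (Homeomorph.mulLeft₀ R⁻¹ (inv_ne_zero hR))).mul_left

lemma stretch_nonneg {R : ℝ} (hR : 0 ≤ R) {f : ℝ → ℝ} (hf : 0 ≤ f) : 0 ≤ stretch R f :=
  fun _ => mul_nonneg (inv_nonneg.2 hR) (hf _)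

lemma fourierInv_ofReal_stretch {R : ℝ} (hR : 0 < R) (f : ℝ → ℝ) (y : ℝ) :
    𝓕⁻ (fun x => (stretch R f x : ℂ)) y = 𝓕⁻ (fun x => (f x : ℂ)) (R * y) := by
  have hscale := Measure.integral_comp_inv_mul_left (fun x => 𝐞 (x * (R * y)) • (f x : ℂ)) R
  rw [abs_of_pos hR, ← inv_smul_eq_iff₀ hR.ne', ← integral_smul] at hscale
  simp only [fourierInv_eq, RCLike.inner_apply, conj_trivial, mul_comm (R * y)]
  rw [← hscale]
  congr! 2 with x
  rw [show R⁻¹ * x * (R * y) = y * x by field_simp]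
  simp only [stretch, Circle.smul_def, Complex.real_smul, smul_eq_mul, Complex.ofReal_mul]
  ring

lemma norm_fourierInv_le_integral_norm (φ : ℝ → ℂ) (y : ℝ) : ‖𝓕⁻ φ y‖ ≤ ∫ x, ‖φ x‖ :=
  VectorFourier.norm_fourierIntegral_le_integral_norm _ _ _ _ _

lemma tendsto_fourierInv_mul_atTop (φ : ℝ → ℂ) {y : ℝ} (hy : y ≠ 0) :
    Tendsto (fun R => 𝓕⁻ φ (R * y)) atTop (𝓝 0) := by
  have hcocompact : Tendsto (fun R => R * -y) (cocompact ℝ) (cocompact ℝ) :=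
    tendsto_cocompact_mul_right₀ (neg_ne_zero.2 hy)
  simpa only [fourierInv_eq_fourier_neg, mul_neg, Function.comp_def] using
    (Real.zero_at_infty_fourier φ).comp (hcocompact.mono_left atTop_le_cocompact)

/-- A smoothing of `stretch R f` by `f`. Its inverse Fourier transform concentrates at `0` as
`R → ∞`, like that of `stretch R f`, but is dominated by that of `f`. -/
noncomputable def spread (R : ℝ) (f : ℝ → ℝ) : ℝ → ℝ :=
  f ⋆[ContinuousLinearMap.mul ℝ ℝ] stretch R f

lemma continuous_spread {R : ℝ} (hR : R ≠ 0) {f : ℝ → ℝ} (hf : Continuous f)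
    (hc : HasCompactSupport f) : Continuous (spread R f) :=
  (hasCompactSupport_stretch hR hc).continuous_convolution_right _ hf.locallyIntegrable
    (continuous_stretch R hf)

lemma hasCompactSupport_spread {R : ℝ} (hR : R ≠ 0) {f : ℝ → ℝ} (hc : HasCompactSupport f) :
    HasCompactSupport (spread R f) :=
  hc.convolution _ (hasCompactSupport_stretch hR hc)

lemma fourierInv_ofReal_spread {R : ℝ} (hR : 0 < R) {f : ℝ → ℝ} (hf : Integrable f) (y : ℝ) :
    𝓕⁻ (fun x => (spread R f x : ℂ)) y =
      𝓕⁻ (fun x => (f x : ℂ)) y * 𝓕⁻ (fun x => (f x : ℂ)) (R * y) := by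
  have hstretch : Integrable (stretch R f) :=
    (hf.comp_mul_left' (inv_ne_zero hR.ne')).const_mul R⁻¹
  rw [← fourierInv_ofReal_stretch hR]
  simp only [spread, ← ofReal_convolution, fourierInv_eq_fourier_neg]
  exact Real.fourier_mul_convolution_eq hf.ofReal hstretch.ofReal _

lemma tendsto_integral_norm_sq_fourierInv_spread {ν : Measure ℝ} {f : ℝ → ℝ} (hf : Integrable f)
    (hf₁ : ∫ x, f x = 1) (k : ℝ) (hν : MemLp (fun y => 𝓕⁻ (fun x => (f x : ℂ)) (y - k)) 2 ν) :
    Tendsto (fun R => ∫ y, ‖𝓕⁻ (fun x => (spread R f x : ℂ)) (y - k)‖ ^ 2 ∂ν) atTop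
      (𝓝 (ν.real {k})) := by
  set F := 𝓕⁻ (fun x => (f x : ℂ)) with hF
  have hFcont : Continuous F :=
    VectorFourier.fourierIntegral_continuous continuous_fourierChar (by fun_prop) hf.ofReal
  have hF₀ : F 0 = 1 := by
    simp [hF, fourierInv_eq, integral_complex_ofReal, hf₁]
  set C := ∫ x, ‖(f x : ℂ)‖
  have hFC (y : ℝ) : ‖F y‖ ≤ C := norm_fourierInv_le_integral_norm _ y
  have hatom : ν.real {k} = ∫ y, Set.indicator {k} (fun _ => (1 : ℝ)) y ∂ν := by
    rw [integral_indicator_const _ (measurableSet_singleton k), smul_eq_mul, mul_one]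
  suffices Tendsto (fun R => ∫ y, ‖F (y - k) * F (R * (y - k))‖ ^ 2 ∂ν) atTop (𝓝 (ν.real {k})) by
    refine this.congr' ?_
    filter_upwards [eventually_gt_atTop 0] with R hR
    simp only [fourierInv_ofReal_spread hR hf, hF]
  rw [hatom]
  refine tendsto_integral_filter_of_dominated_convergence (fun y => ‖F (y - k)‖ ^ 2 * C ^ 2)
    (Eventually.of_forall fun R => Continuous.aestronglyMeasurable (by fun_prop))
    (Eventually.of_forall fun R => Eventually.of_forall fun y => ?_)
    (((memLp_two_iff_integrable_sq_norm hν.1).1 hν).mul_const _)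
    (Eventually.of_forall fun y => ?_)
  · rw [norm_pow, norm_norm, norm_mul, mul_pow]
    gcongr
    exact hFC _
  · rcases eq_or_ne y k with rfl | hy
    · simp [hF₀]
    · rw [Set.indicator_of_notMem (by simpa using hy)]
      simpa using
        ((tendsto_fourierInv_mul_atTop _ (sub_ne_zero.2 hy)).const_mul (F (y - k))).norm.pow 2

namespace IsFourierTransform

variable {γ ν : Measure ℝ}

lemma memLp_fourierInv_sub (h : IsFourierTransform γ ν) (k : ℝ) {φ : ℝ → ℂ} (hφ : Continuous φ)
    (hc : HasCompactSupport φ) : MemLp (fun y => 𝓕⁻ φ (y - k)) 2 ν := by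
  simpa only [← fourierInv_modulate] using
    (h.2 _ (continuous_modulate k hφ) (hasCompactSupport_modulate k hc)).1

lemma integral_fourierChar_smul (h : IsFourierTransform γ ν) (k : ℝ) {φ : ℝ → ℂ}
    (hφ : Continuous φ) (hc : HasCompactSupport φ) :
    ∫ x, 𝐞 (-(k * x)) • (φ ⋆[ContinuousLinearMap.mul ℂ ℂ] fun y => conj (φ (-y))) x ∂γ =
      ((∫ y, ‖𝓕⁻ φ (y - k)‖ ^ 2 ∂ν : ℝ) : ℂ) := by
  simpa only [modulate_convolution_conj_neg, fourierInv_modulate] using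
    (h.2 _ (continuous_modulate k hφ) (hasCompactSupport_modulate k hc)).2

variable [IsLocallyFiniteMeasure γ]

lemma integral_cos_mul_selfCorrelation (h : IsFourierTransform γ ν) (k : ℝ) {f : ℝ → ℝ}
    (hf : Continuous f) (hc : HasCompactSupport f) :
    ∫ x, cos (2 * π * k * x) * selfCorrelation f x ∂γ =
      ∫ y, ‖𝓕⁻ (fun x => (f x : ℂ)) (y - k)‖ ^ 2 ∂ν := by
  have hcomplex := h.integral_fourierChar_smul k (φ := fun x => (f x : ℂ)) (by fun_prop)
    (hc.comp_left Complex.ofReal_zero)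
  simp only [Complex.conj_ofReal, ofReal_convolution] at hcomplex
  have hint : Integrable (fun x => 𝐞 (-(k * x)) • (selfCorrelation f x : ℂ)) γ :=
    (integrable_selfCorrelation hf hc γ).ofReal.bdd_mul (c := 1)
      (Continuous.aestronglyMeasurable (by fun_prop))
      (Eventually.of_forall fun x => (Circle.norm_coe _).le)
  have hre := congrArg Complex.re hcomplex
  rw [Complex.ofReal_re] at hre
  rw [← hre]
  refine .trans ?_ (integral_re hint)
  congr! 2 with x
  rw [Circle.smul_def, fourierChar_apply, smul_eq_mul, RCLike.re_eq_complex_re,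
    Complex.re_mul_ofReal, Complex.exp_ofReal_mul_I_re, mul_neg, cos_neg, mul_assoc (2 * π)]

theorem mul_measureReal_zero_le (h : IsFourierTransform γ ν) {k a : ℝ}
    (hk : ∀ᵐ x ∂γ, a ≤ cos (2 * π * k * x)) : a * ν.real {0} ≤ ν.real {k} := by
  let f : ℝ → ℝ := (default : ContDiffBump (0 : ℝ)).normed volume
  have hf : Continuous f := ContDiffBump.continuous_normed _
  have hc : HasCompactSupport f := ContDiffBump.hasCompactSupport_normed _
  have hf₀ : 0 ≤ f := ContDiffBump.nonneg_normed _
  have hlim (k : ℝ) := tendsto_integral_norm_sq_fourierInv_spread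
    (hf.integrable_of_hasCompactSupport hc) (ContDiffBump.integral_normed _) k
    (h.memLp_fourierInv_sub k (by fun_prop) (hc.comp_left Complex.ofReal_zero))
  refine le_of_tendsto_of_tendsto ((hlim 0).const_mul a) (hlim k) ?_
  filter_upwards [eventually_gt_atTop 0] with R hR
  have hg : Continuous (spread R f) := continuous_spread hR.ne' hf hc
  have hgc : HasCompactSupport (spread R f) := hasCompactSupport_spread hR.ne' hc
  have hg₀ : 0 ≤ spread R f := convolution_nonneg hf₀ (stretch_nonneg hR.le hf₀)
  have hint := integrable_selfCorrelation hg hgc γ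
  rw [← h.integral_cos_mul_selfCorrelation 0 hg hgc, ← h.integral_cos_mul_selfCorrelation k hg hgc,
    ← integral_const_mul]
  refine integral_mono_ae ?_ ?_ ?_
  · simpa using hint.const_mul a
  · exact hint.bdd_mul (c := 1) (Continuous.aestronglyMeasurable (by fun_prop))
      (Eventually.of_forall fun x => abs_cos_le_one _)
  · filter_upwards [hk] with x hx
    simpa using mul_le_mul_of_nonneg_right hx (selfCorrelation_nonneg hg₀ x)

end IsFourierTransform

end Fourier

lemma one_sub_sq_div_two_le_cos_of_mem_goldenModelSet {c δ : ℝ} (hc : 0 < c) {p : ℝ × ℝ}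
    (hp : p ∈ goldenLattice) (hpδ : |p.2| ≤ √5 * δ / (2 * π * c)) {z : ℝ}
    (hz : z ∈ goldenModelSet (Set.Icc (-c) c)) :
    1 - δ ^ 2 / 2 ≤ cos (2 * π * (p.1 / √5) * z) := by
  obtain ⟨w, hw, hzw⟩ := mem_goldenModelSet_iff.1 hz
  have hangle : |2 * π * (p.2 / √5) * w| ≤ δ := calc
    |2 * π * (p.2 / √5) * w| = 2 * π * (|p.2| / √5) * |w| := by
      simp only [abs_mul, abs_div, abs_two, abs_of_pos pi_pos, abs_of_nonneg (Real.sqrt_nonneg 5)]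
    _ ≤ 2 * π * (|p.2| / √5) * c := by gcongr; exact abs_le.2 hw
    _ ≤ 2 * π * (√5 * δ / (2 * π * c) / √5) * c := by gcongr
    _ = δ := by field_simp
  rw [goldenLattice.cos_two_pi_mul_fst_eq_cos_snd hp hzw]
  calc 1 - δ ^ 2 / 2 ≤ 1 - (2 * π * (p.2 / √5) * w) ^ 2 / 2 := by
        gcongr 1 - ?_ / 2
        exact sq_le_sq.2 (hangle.trans (le_abs_self δ))
    _ ≤ cos (2 * π * (p.2 / √5) * w) := one_sub_sq_div_two_le_cos

theorem IsFourierTransform.exists_mem_Icc_mul_braggIntensity_zero_le {c : ℝ} (hc : 0 < c)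
    {γ ν : Measure ℝ} [IsLocallyFiniteMeasure γ]
    (hγ : ∀ᵐ z ∂γ, z ∈ goldenModelSet (Set.Icc (-c) c)) (h : IsFourierTransform γ ν) {δ : ℝ}
    (hδ : 0 < δ) (x : ℝ) :
    ∃ k ∈ Set.Icc x (x + c * π * goldenRatio ^ 4 / (5 * δ)),
      (1 - δ ^ 2 / 2) * braggIntensity ν 0 ≤ braggIntensity ν k := by
  have h5 : (0 : ℝ) < √5 := by positivity
  obtain ⟨p, hp, ⟨hp₁, hp₂⟩, hp'⟩ := goldenLattice.exists_fst_mem_Icc_abs_snd_le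
    (η := √5 * δ / (2 * π * c)) (by positivity) (x * √5)
  refine ⟨p.1 / √5, ⟨(le_div_iff₀ h5).2 hp₁, (div_le_iff₀ h5).2 (hp₂.trans_eq ?_)⟩, ?_⟩
  · field_simp
    rw [Real.sq_sqrt (by norm_num : (0 : ℝ) ≤ 5)]
    ring
  · exact h.mul_measureReal_zero_le <|
      hγ.mono fun _ => one_sub_sq_div_two_le_cos_of_mem_goldenModelSet hc hp hp'

theorem mainTheorem8_general {c : ℝ} (hc : 0 < c) {γ ν : Measure ℝ} [IsLocallyFiniteMeasure γ]
    (hγ : ∀ᵐ z ∂γ, z ∈ goldenModelSet (Set.Icc (-c) c)) (hν : IsFourierTransform γ ν)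
    (h₀ : HasBraggPeak ν 0) :
    (∀ ε : ℝ, 0 < ε → ε < 1 → ∀ x : ℝ,
      ∃ k ∈ Set.Icc x (x + c * π * goldenRatio ^ 4 / (5 * ε)),
        HasBraggPeak ν k ∧ (1 - ε) * braggIntensity ν 0 ≤ braggIntensity ν k) ∧
    (∀ x : ℝ, ∃ k ∈ Set.Icc x (x + c * π * goldenRatio ^ 4 / 5), HasBraggPeak ν k) := by
  have hI : 0 < braggIntensity ν 0 := h₀
  refine ⟨fun ε hε hε₁ x => ?_, fun x => ?_⟩
  · obtain ⟨k, hk, hle⟩ := hν.exists_mem_Icc_mul_braggIntensity_zero_le hc hγ hε x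
    have hle' : (1 - ε) * braggIntensity ν 0 ≤ braggIntensity ν k :=
      le_trans (by gcongr; nlinarith) hle
    exact ⟨k, hk, (mul_pos (sub_pos.2 hε₁) hI).trans_le hle', hle'⟩
  · obtain ⟨k, hk, hle⟩ := hν.exists_mem_Icc_mul_braggIntensity_zero_le hc hγ one_pos x
    rw [mul_one] at hk
    exact ⟨k, hk, (mul_pos (by norm_num) hI).trans_le hle⟩

theorem mainTheorem8 (Λ : Set ℝ) (hΛ : Λ ⊆ Fib)
    (A : ℕ → Set ℝ) (hA : IsVanHove A)
    (ν : Measure ℝ) (hν : IsDiffractionMeasure Λ A ν)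
    (I : ℝ) (hI : braggIntensity ν 0 = I) (hIpos : 0 < I) :
    (∀ ε : ℝ, 0 < ε → ε < 1 → ∀ x : ℝ,
      ∃ k ∈ Set.Icc x (x + 2 * π * goldenRatio ^ 4 / (5 * ε)),
        HasBraggPeak ν k ∧ (1 - ε) * I ≤ braggIntensity ν k) ∧
    (∀ x : ℝ, ∃ k ∈ Set.Icc x (x + 2 * π * goldenRatio ^ 4 / 5), HasBraggPeak ν k) := by
  subst hI
  obtain ⟨γ, hγ, hF⟩ := hν
  have := hγ.isLocallyFiniteMeasure_of_subset_Fib hΛ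
  exact mainTheorem8_general two_pos (hγ.ae_mem_goldenModelSet_of_subset_Fib hΛ) hF hIpos
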